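/- Let $G$ be a real 3-dimensional (smooth) Lie group of Bianchi type A, i.e. a Lie group whose Lie algebra has a basis $e_1,e_2,e_3$ with $$[e_2,e_3]=b_1e_1,\qquad [e_3,e_1]=b_2e_2,\qquad [e_1,e_2]=b_3e_3,$$ where $(b_1,b_2,b_3)$ is one of $(0,0,0)$ (type I), $(0,0,1)$ (type II), $(0,1,-1)$ (type VI$_0$), $(0,1,1)$ (type VII$_0$), $(1,1,-1)$ (type VIII), $(1,1,1)$ (type IX). Then there exist smooth Riemannian metrics $\hat g$ and $g$ on the manifold $G\times\mathbb R$ such that 1. $\hat g$ is complete, i.e. every Cauchy sequence for the Riemannian distance of $\hat g$ converges; 2. $g$ is hyper-Kähler, i.e. there are smooth almost complex structures $J_1,J_2,J_3$ on $G\times\mathbb R$ with $J_1J_2=-J_2J_1=J_3$ which satisfy $g(J_s\cdot,J_s\cdot)=g(\cdot,\cdot)$ and are parallel with respect to the Levi-Civita connection of $g$ for $s=1,2,3$; 3. $\hat g$ is globally conformal to $g$, i.e. $\hat g=\varphi\, g$ for a smooth positive function $\varphi:G\times\mathbb R\to\mathbb R$. -/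

import Mathlib

open Bundle Filter Manifold
open scoped ContDiff Topology ENNReal

noncomputable section

/-! ### Three-dimensional real Lie algebras of Bianchi type A -/

/-- The six types of class A in the Bianchi classification of three-dimensional real Lie
algebras. -/
inductive BianchiA where
  | I
  | II
  | VI0
  | VII0
  | VIII
  | IX

/-- The structure constants `(b₁, b₂, b₃)` of each type of class A. -/
def BianchiA.b : BianchiA → Fin 3 → ℝ
  | .I => ![0, 0, 0]
  | .II => ![0, 0, 1]
  | .VI0 => ![0, 1, -1]
  | .VII0 => ![0, 1, 1]
  | .VIII => ![1, 1, -1]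
  | .IX => ![1, 1, 1]

/-- A real Lie algebra is of Bianchi type A if for one of the six types it has a basis
`e₁, e₂, e₃` with `[e₂, e₃] = b₁ e₁`, `[e₃, e₁] = b₂ e₂`, `[e₁, e₂] = b₃ e₃`; in terms of the dual
basis, `de¹ = -b₁ e² ∧ e³`, `de² = -b₂ e³ ∧ e¹`, `de³ = -b₃ e¹ ∧ e²`. -/
def IsBianchiTypeA (L : Type*) [LieRing L] [LieAlgebra ℝ L] : Prop :=
  ∃ (t : BianchiA) (e : Module.Basis (Fin 3) ℝ L),
    ⁅e 1, e 2⁆ = t.b 0 • e 0 ∧ ⁅e 2, e 0⁆ = t.b 1 • e 1 ∧ ⁅e 0, e 1⁆ = t.b 2 • e 2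

/-- A smooth real Lie group is regular enough for Mathlib's Lie algebra structure on its tangent
space at the identity. -/
instance LieGroup.instMinSmoothnessReal {E : Type*} [NormedAddCommGroup E] [NormedSpace ℝ E]
    {H : Type*} [TopologicalSpace H] {I : ModelWithCorners ℝ E H}
    {G : Type*} [TopologicalSpace G] [ChartedSpace H G] [Group G] [LieGroup I ∞ G] :
    LieGroup I (minSmoothness ℝ 3) G :=
  LieGroup.of_le (n := ∞) (by
    rw [minSmoothness_of_isRCLikeNormedField]
    exact ENat.LEInfty.out)

/-! ### Riemannian metrics on a smooth manifold -/

section Riemannian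

variable {E : Type*} [NormedAddCommGroup E] [NormedSpace ℝ E]
  {H : Type*} [TopologicalSpace H] (I : ModelWithCorners ℝ E H)
  (M : Type*) [TopologicalSpace M] [ChartedSpace H M] [IsManifold I ∞ M]

/-- Smooth Riemannian metrics on the manifold `M`. -/
abbrev SmoothMetric : Type _ :=
  ContMDiffRiemannianMetric I ∞ E (fun x : M ↦ TangentSpace I x)

variable {I M}

/-- The Riemannian distance of `g` (infimum of the `g`-lengths of `C^1` paths; it is `∞` between
different components). -/
def SmoothMetric.edist (g : SmoothMetric I M) (x y : M) : ℝ≥0∞ :=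
  letI : RiemannianBundle (fun x : M ↦ TangentSpace I x) := ⟨g.toRiemannianMetric⟩
  riemannianEDist I x y

/-- A Riemannian metric is complete if every sequence that is Cauchy for its Riemannian distance
converges for that distance. -/
def SmoothMetric.IsComplete (g : SmoothMetric I M) : Prop :=
  ∀ u : ℕ → M,
    (∀ ε : ℝ≥0∞, 0 < ε → ∃ N : ℕ, ∀ m n : ℕ, N ≤ m → N ≤ n → g.edist (u m) (u n) < ε) →
    ∃ x : M, Tendsto (fun n ↦ g.edist (u n) x) atTop (𝓝 0)

/-- `g'` is globally conformal to `g`: `g' = φ g` for a smooth positive function `φ` defined on the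
whole manifold. -/
def SmoothMetric.IsGloballyConformal (g' g : SmoothMetric I M) : Prop :=
  ∃ φ : M → ℝ, ContMDiff I 𝓘(ℝ, ℝ) ∞ φ ∧ (∀ x, 0 < φ x) ∧
    ∀ (x : M) (v w : TangentSpace I x), g'.inner x v w = φ x * g.inner x v w

/-! ### Hyper-Kähler metrics -/

/-- The vector field `Y` is differentiable at `x`. -/
def VectorFieldDiffAt (Y : ∀ x : M, TangentSpace I x) (x : M) : Prop :=
  MDifferentiableAt I (I.prod 𝓘(ℝ, E)) (fun y ↦ (⟨y, Y y⟩ : TangentBundle I M)) x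

/-- `∇` is compatible with `g`: `v(g(Y, Z)) = g(∇_v Y, Z) + g(Y, ∇_v Z)` for all vector fields
`Y, Z` which are differentiable at `x` and all tangent vectors `v` at `x`. -/
def SmoothMetric.IsCompatible (g : SmoothMetric I M)
    (cov : CovariantDerivative I E (fun x : M ↦ TangentSpace I x)) : Prop :=
  ∀ (Y Z : ∀ x : M, TangentSpace I x) (x : M), VectorFieldDiffAt Y x → VectorFieldDiffAt Z x →
    ∀ v : TangentSpace I x,
      mvfderiv I (fun y ↦ g.inner y (Y y) (Z y)) x v =
        g.inner x (cov Y x v) (Z x) + g.inner x (Y x) (cov Z x v)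

/-- `∇` is the Levi-Civita connection of `g`: it is torsion-free and compatible with `g`. -/
def SmoothMetric.IsLeviCivita [FiniteDimensional ℝ E] (g : SmoothMetric I M)
    (cov : CovariantDerivative I E (fun x : M ↦ TangentSpace I x)) : Prop :=
  cov.torsion = 0 ∧ g.IsCompatible cov

/-- The field of endomorphisms `J` of the tangent bundle is smooth. -/
def IsSmoothEndo (J : ∀ x : M, TangentSpace I x →L[ℝ] TangentSpace I x) : Prop :=
  ContMDiff I (I.prod 𝓘(ℝ, E →L[ℝ] E)) ∞
    (fun x ↦ (⟨x, J x⟩ : TotalSpace (E →L[ℝ] E)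
      (fun x : M ↦ TangentSpace I x →L[ℝ] TangentSpace I x)))

/-- `∇ J = 0`, that is, `∇_v (J Y) = J (∇_v Y)` for every vector field `Y` which is differentiable
at `x` and every tangent vector `v` at `x`. -/
def IsParallelEndo (cov : CovariantDerivative I E (fun x : M ↦ TangentSpace I x))
    (J : ∀ x : M, TangentSpace I x →L[ℝ] TangentSpace I x) : Prop :=
  ∀ (Y : ∀ x : M, TangentSpace I x) (x : M), VectorFieldDiffAt Y x →
    ∀ v : TangentSpace I x, cov (fun y ↦ J y (Y y)) x v = J x (cov Y x v)

/-- `(J₁, J₂, J₃)` is an almost hypercomplex structure: a triple of smooth almost complex structures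
with `J₁ J₂ = - J₂ J₁ = J₃`. -/
structure IsAlmostHypercomplex
    (J : Fin 3 → ∀ x : M, TangentSpace I x →L[ℝ] TangentSpace I x) : Prop where
  smooth (s : Fin 3) : IsSmoothEndo (J s)
  sq (s : Fin 3) (x : M) (v : TangentSpace I x) : J s x (J s x v) = -v
  mul (x : M) (v : TangentSpace I x) : J 0 x (J 1 x v) = J 2 x v
  mul_swap (x : M) (v : TangentSpace I x) : J 1 x (J 0 x v) = -J 2 x v

/-- `g` is a hyper-Kähler metric: there is an almost hypercomplex structure `(J₁, J₂, J₃)` on `M`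
for which `g` is almost hyper-Hermitian and which is parallel for the Levi-Civita connection of
`g`. -/
def SmoothMetric.IsHyperKahler [FiniteDimensional ℝ E] (g : SmoothMetric I M) : Prop :=
  ∃ J : Fin 3 → ∀ x : M, TangentSpace I x →L[ℝ] TangentSpace I x,
    IsAlmostHypercomplex J ∧
    (∀ (s : Fin 3) (x : M) (v w : TangentSpace I x),
      g.inner x (J s x v) (J s x w) = g.inner x v w) ∧
    ∃ cov : CovariantDerivative I E (fun x : M ↦ TangentSpace I x),
      g.IsLeviCivita cov ∧ ∀ s, IsParallelEndo cov (J s)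

end Riemannian

end

noncomputable section

section RelatedVectorFields

open VectorField

variable {E : Type*} [NormedAddCommGroup E] [NormedSpace ℝ E]
  {H : Type*} [TopologicalSpace H] {I : ModelWithCorners ℝ E H}
  {M : Type*} [TopologicalSpace M] [ChartedSpace H M]
  {E' : Type*} [NormedAddCommGroup E'] [NormedSpace ℝ E']
  {H' : Type*} [TopologicalSpace H'] {I' : ModelWithCorners ℝ E' H'}
  {N : Type*} [TopologicalSpace N] [ChartedSpace H' N]

theorem fderiv_lieBracket_of_related {φ : E → E'} {v w : E → E} {v' w' : E' → E'} {x : E}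
    (hφ : ContDiffAt ℝ 2 φ x)
    (hv : DifferentiableAt ℝ v x) (hw : DifferentiableAt ℝ w x)
    (hv' : DifferentiableAt ℝ v' (φ x)) (hw' : DifferentiableAt ℝ w' (φ x))
    (hvv' : ∀ᶠ y in 𝓝 x, fderiv ℝ φ y (v y) = v' (φ y))
    (hww' : ∀ᶠ y in 𝓝 x, fderiv ℝ φ y (w y) = w' (φ y)) :
    fderiv ℝ φ x (lieBracket ℝ v w x) = lieBracket ℝ v' w' (φ x) := by
  have hd : DifferentiableAt ℝ φ x := hφ.differentiableAt two_ne_zero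
  rw [fderiv_apply_lieBracket hφ (by simp) hw hv,
    Filter.EventuallyEq.fderiv_eq (f := fun y ↦ v' (φ y)) hvv',
    Filter.EventuallyEq.fderiv_eq (f := fun y ↦ w' (φ y)) hww',
    fderiv_fun_comp x hv' hd, fderiv_fun_comp x hw' hd, lieBracket_eq]
  simp [hvv'.self_of_nhds, hww'.self_of_nhds]

/-- A vector field read in the chart at `x₀`. -/
def vectorFieldInChart (V : ∀ x : M, TangentSpace I x) (x₀ : M) : E → E :=
  mpullbackWithin 𝓘(ℝ, E) I (extChartAt I x₀).symm V (Set.range I)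

variable [IsManifold I ∞ M]

theorem mlieBracket_eq_lieBracket_vectorFieldInChart [I.Boundaryless]
    (V W : ∀ x : M, TangentSpace I x) (x : M) :
    mlieBracket I V W x =
      lieBracket ℝ (vectorFieldInChart V x) (vectorFieldInChart W x) (extChartAt I x x) := by
  have h : (mfderiv I 𝓘(ℝ, E) (extChartAt I x) x : E →L[ℝ] E).inverse =
      ContinuousLinearMap.id ℝ E := by
    rw [← ContinuousLinearMap.inverse_id]
    exact congrArg (ContinuousLinearMap.inverse : (E →L[ℝ] E) → _) mfderiv_extChartAt_self
  have h' : lieBracketWithin ℝ (vectorFieldInChart V x) (vectorFieldInChart W x)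
      ((extChartAt I x).symm ⁻¹' Set.univ ∩ Set.range I) (extChartAt I x x) =
      lieBracket ℝ (vectorFieldInChart V x) (vectorFieldInChart W x) (extChartAt I x x) := by
    rw [Set.preimage_univ, Set.univ_inter, I.range_eq_univ, lieBracketWithin_univ]
  rw [← mlieBracketWithin_univ, mlieBracketWithin_apply, ← h']
  exact congr($h _)

theorem vectorFieldInChart_apply [I.Boundaryless] (V : ∀ x : M, TangentSpace I x) {x₀ : M}
    {y : E} (hy : y ∈ (extChartAt I x₀).target) :
    vectorFieldInChart V x₀ y = mfderiv I 𝓘(ℝ, E) (extChartAt I x₀) ((extChartAt I x₀).symm y)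
        (V ((extChartAt I x₀).symm y)) := by
  rw [vectorFieldInChart, mpullbackWithin_apply, ContinuousLinearMap.inverse_eq
    (mfderivWithin_extChartAt_symm_comp_mfderiv_extChartAt hy)
    (mfderiv_extChartAt_comp_mfderivWithin_extChartAt_symm hy)]
  rfl

theorem VectorFieldDiffAt.differentiableAt_vectorFieldInChart [CompleteSpace E] [I.Boundaryless]
    {V : ∀ x : M, TangentSpace I x} {x : M} (hV : VectorFieldDiffAt V x) :
    DifferentiableAt ℝ (vectorFieldInChart V x) (extChartAt I x x) := by
  have h : DifferentiableWithinAt ℝ (vectorFieldInChart V x)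
      ((extChartAt I x).symm ⁻¹' Set.univ ∩ Set.range I) (extChartAt I x x) :=
    MDifferentiableWithinAt.differentiableWithinAt_mpullbackWithin_vectorField
      (mdifferentiableWithinAt_univ.2 hV)
  rwa [Set.preimage_univ, Set.univ_inter, I.range_eq_univ, differentiableWithinAt_univ] at h

variable [IsManifold I' ∞ N] [CompleteSpace E] [CompleteSpace E']
  [I.Boundaryless] [I'.Boundaryless]

/-- The derivative of a map sends the Lie bracket of two vector fields to the Lie bracket of two
vector fields which are related to them. -/
theorem mfderiv_mlieBracket_of_related {φ : M → N}
    {V W : ∀ x : M, TangentSpace I x} {V' W' : ∀ x : N, TangentSpace I' x} {x : M}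
    (hφ : ContMDiff I I' 2 φ)
    (hV : VectorFieldDiffAt V x) (hW : VectorFieldDiffAt W x)
    (hV' : VectorFieldDiffAt V' (φ x)) (hW' : VectorFieldDiffAt W' (φ x))
    (hVV' : ∀ y, mfderiv I I' φ y (V y) = V' (φ y))
    (hWW' : ∀ y, mfderiv I I' φ y (W y) = W' (φ y)) :
    mfderiv I I' φ x (mlieBracket I V W x) = mlieBracket I' V' W' (φ x) := by
  set c := extChartAt I x with hc
  set d := extChartAt I' (φ x) with hd
  set ψ : E → E' := writtenInExtChartAt I I' x φ with hψ
  have hψx : ψ (c x) = d (φ x) := by simp [hψ, writtenInExtChartAt, hc, hd]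
  have h2 : ContDiffAt ℝ 2 ψ (c x) := by
    have := (contMDiffAt_iff.1 (hφ x)).2
    rwa [I.range_eq_univ, contDiffWithinAt_univ] at this
  have hdφ : MDifferentiable I I' φ := hφ.mdifferentiable two_ne_zero
  have key (U : ∀ x : M, TangentSpace I x) (U' : ∀ x : N, TangentSpace I' x)
      (hUU' : ∀ y, mfderiv I I' φ y (U y) = U' (φ y)) : ∀ᶠ y in 𝓝 (c x),
      fderiv ℝ ψ y (vectorFieldInChart U x y) =
        vectorFieldInChart U' (φ x) (ψ y) := by
    have hφc : ContinuousAt (φ ∘ c.symm) (c x) :=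
      ContinuousAt.comp (by simpa [hc] using hφ.continuous.continuousAt)
        (continuousAt_extChartAt_symm x)
    have hsrc : ∀ᶠ y in 𝓝 (c x), φ (c.symm y) ∈ d.source := by
      refine hφc.preimage_mem_nhds (t := d.source) ?_
      simpa [hc, hd] using extChartAt_source_mem_nhds (I := I') (φ x)
    filter_upwards [extChartAt_target_mem_nhds (I := I) x, hsrc,
      eventually_eventually_nhds.2 hsrc] with y hy hys hys'
    have hψy : ψ y = d (φ (c.symm y)) := rfl
    have hdy : ψ y ∈ d.target := hψy ▸ d.map_source hys
    have hdd : d.symm (ψ y) = φ (c.symm y) := by rw [hψy, d.left_inv hys]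
    have hcy : c.symm y ∈ (chartAt H x).source := by
      rw [← extChartAt_source (I := I)]; exact c.map_target hy
    have hdsrc : φ (c.symm y) ∈ (chartAt H' (φ x)).source := by
      rw [← extChartAt_source (I := I')]; exact hys
    have h3 : MDifferentiableAt 𝓘(ℝ, E) I c.symm y := by
      have := mdifferentiableWithinAt_extChartAt_symm (I := I) hy
      rwa [I.range_eq_univ, mdifferentiableWithinAt_univ] at this
    have h4 : MDifferentiableAt I' 𝓘(ℝ, E') d (φ (c.symm y)) := mdifferentiableAt_extChartAt hdsrc
    have h5 : fderiv ℝ ψ y = (mfderiv I' 𝓘(ℝ, E') d (φ (c.symm y))).comp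
        ((mfderiv I I' φ (c.symm y)).comp (mfderiv 𝓘(ℝ, E) I c.symm y)) := by
      rw [← mfderiv_eq_fderiv, show ψ = d ∘ (φ ∘ c.symm) from rfl,
        mfderiv_comp y h4 ((hdφ _).comp y h3), mfderiv_comp y (hdφ _) h3]
      rfl
    rw [h5]
    have h6 : vectorFieldInChart U' (φ x) (ψ y) =
        mfderiv I' 𝓘(ℝ, E') d (φ (c.symm y)) (U' (φ (c.symm y))) := by
      rw [vectorFieldInChart_apply U' hdy, hdd]
    have h7 : (mfderiv 𝓘(ℝ, E) I c.symm y : E →L[ℝ] TangentSpace I (c.symm y))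
        (vectorFieldInChart (E := E) U x y) = U (c.symm y) := by
      rw [vectorFieldInChart_apply U hy]
      have := mfderivWithin_extChartAt_symm_comp_mfderiv_extChartAt (I := I) hy
      rw [I.range_eq_univ, mfderivWithin_univ] at this
      exact congr($this (U (c.symm y)))
    rw [h6, ← hUU', ← h7]
    rfl
  have h := fderiv_lieBracket_of_related h2 hV.differentiableAt_vectorFieldInChart
    hW.differentiableAt_vectorFieldInChart (hψx ▸ hV'.differentiableAt_vectorFieldInChart)
    (hψx ▸ hW'.differentiableAt_vectorFieldInChart) (key V V' hVV') (key W W' hWW')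
  rw [mlieBracket_eq_lieBracket_vectorFieldInChart, mlieBracket_eq_lieBracket_vectorFieldInChart,
    ← hd, ← hψx, ← h, (hdφ x).mfderiv, I.range_eq_univ, fderivWithin_univ]
  rfl

end RelatedVectorFields

theorem contDiff_bilinearComp_self {E V : Type*} [NormedAddCommGroup E] [NormedSpace ℝ E]
    [FiniteDimensional ℝ E] [NormedAddCommGroup V] [NormedSpace ℝ V] (B : V →L[ℝ] V →L[ℝ] ℝ) :
    ContDiff ℝ ∞ (fun T : E →L[ℝ] V ↦ B.bilinearComp T T) := by
  refine contDiff_clm_apply_iff.2 fun v ↦ contDiff_clm_apply_iff.2 fun w ↦ ?_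
  have h (u : E) : ContDiff ℝ ∞ (fun T : E →L[ℝ] V ↦ T u) :=
    contDiff_id.clm_apply contDiff_const
  exact ((contDiff_const (c := B)).clm_apply (h v)).clm_apply (h w)

/-! ### Absolute parallelisms -/

section Parallelism

variable {E : Type*} [NormedAddCommGroup E] [NormedSpace ℝ E]
  {H : Type*} [TopologicalSpace H] (I : ModelWithCorners ℝ E H)
  (M : Type*) [TopologicalSpace M] [ChartedSpace H M] [IsManifold I ∞ M]
  (V : Type*) [NormedAddCommGroup V] [NormedSpace ℝ V]

/-- A smooth trivialization `TM ≃ M × V` of the tangent bundle. -/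
structure Parallelism where
  equiv (x : M) : TangentSpace I x ≃L[ℝ] V
  smooth (x₀ : M) : ContMDiffAt I 𝓘(ℝ, E →L[ℝ] V) ∞
    (fun x ↦ (equiv x : TangentSpace I x →L[ℝ] V) ∘L
      (trivializationAt E (TangentSpace I) x₀).symmL ℝ x) x₀

namespace Parallelism

variable {I M V} (θ : Parallelism I M V)

/-- The parallelism in the trivialization of the tangent bundle at `x₀`. -/
def coord (x₀ x : M) : E →L[ℝ] V :=
  (θ.equiv x : TangentSpace I x →L[ℝ] V) ∘L (trivializationAt E (TangentSpace I) x₀).symmL ℝ x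

theorem contMDiffAt_coord (x₀ : M) : ContMDiffAt I 𝓘(ℝ, E →L[ℝ] V) ∞ (θ.coord x₀) x₀ :=
  θ.smooth x₀

theorem eventually_mem_baseSet (x₀ : M) :
    ∀ᶠ x in 𝓝 x₀, x ∈ (trivializationAt E (TangentSpace I : M → Type _) x₀).baseSet :=
  (trivializationAt E (TangentSpace I) x₀).open_baseSet.mem_nhds
    (FiberBundle.mem_baseSet_trivializationAt' x₀)

theorem coord_trivializationAt {x₀ x : M}
    (hx : x ∈ (trivializationAt E (TangentSpace I : M → Type _) x₀).baseSet)
    (v : TangentSpace I x) :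
    θ.coord x₀ x (trivializationAt E (TangentSpace I) x₀ ⟨x, v⟩).2 = θ.equiv x v := by
  rw [coord, ContinuousLinearMap.comp_apply, Trivialization.symmL_apply _ hx,
    Trivialization.symm_apply_apply_mk _ hx]
  rfl

theorem isInvertible_coord {x₀ x : M}
    (hx : x ∈ (trivializationAt E (TangentSpace I : M → Type _) x₀).baseSet) :
    (θ.coord x₀ x).IsInvertible :=
  ⟨((trivializationAt E (TangentSpace I) x₀).continuousLinearEquivAt ℝ x hx).symm.trans
    (θ.equiv x), by
      ext v
      rw [coord, ContinuousLinearMap.comp_apply, ContinuousLinearEquiv.coe_coe,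
        ContinuousLinearEquiv.trans_apply, Trivialization.symm_continuousLinearEquivAt_eq]
      rfl⟩

theorem inverse_coord_apply {x₀ x : M}
    (hx : x ∈ (trivializationAt E (TangentSpace I : M → Type _) x₀).baseSet) (u : V) :
    (θ.coord x₀ x).inverse u =
      (trivializationAt E (TangentSpace I) x₀ ⟨x, (θ.equiv x).symm u⟩).2 := by
  obtain ⟨e, he⟩ := θ.isInvertible_coord hx
  rw [← he, ContinuousLinearMap.inverse_equiv]
  have := θ.coord_trivializationAt hx ((θ.equiv x).symm u)
  rw [← he, ContinuousLinearEquiv.apply_symm_apply] at this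
  exact (e.symm_apply_eq).2 this.symm

theorem contMDiffAt_inverse_coord [CompleteSpace E] (x₀ : M) :
    ContMDiffAt I 𝓘(ℝ, V →L[ℝ] E) ∞ (fun x ↦ (θ.coord x₀ x).inverse) x₀ :=
  ((θ.isInvertible_coord
    (FiberBundle.mem_baseSet_trivializationAt' x₀)).contDiffAt_map_inverse).contMDiffAt.comp x₀
      (θ.contMDiffAt_coord x₀)

/-- The vector field which is constant in a parallelism. -/
def constField (u : V) (x : M) : TangentSpace I x := (θ.equiv x).symm u

@[simp]
theorem equiv_constField (u : V) (x : M) : θ.equiv x (θ.constField u x) = u :=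
  (θ.equiv x).apply_symm_apply u

theorem vectorFieldDiffAt_constField [CompleteSpace E] (u : V) (x : M) :
    VectorFieldDiffAt (θ.constField u) x := by
  have h : ContMDiffAt I (I.prod 𝓘(ℝ, E)) ∞
      (fun y ↦ (⟨y, θ.constField u y⟩ : TangentBundle I M)) x := by
    refine (contMDiffAt_section x).2 ?_
    refine ((θ.contMDiffAt_inverse_coord x).clm_apply
      (contMDiffAt_const (c := u))).congr_of_eventuallyEq ?_
    filter_upwards [eventually_mem_baseSet (I := I) x] with y hy
    exact (θ.inverse_coord_apply hy u).symm
  exact h.mdifferentiableAt (by simp)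

theorem mdifferentiableAt_equiv_apply {Y : ∀ x : M, TangentSpace I x} {x : M}
    (hY : VectorFieldDiffAt Y x) : MDifferentiableAt I 𝓘(ℝ, V) (fun y ↦ θ.equiv y (Y y)) x := by
  have h : MDifferentiableAt I 𝓘(ℝ, E)
      (fun y ↦ (trivializationAt E (TangentSpace I) x ⟨y, Y y⟩).2) x :=
    ((mdifferentiableAt_totalSpace I (F := E) (E := TangentSpace I) _ ).1 hY).2
  refine ((((θ.contMDiffAt_coord x).mdifferentiableAt (by simp)).clm_apply
    h)).congr_of_eventuallyEq ?_
  filter_upwards [eventually_mem_baseSet (I := I) x] with y hy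
  exact (θ.coord_trivializationAt hy (Y y)).symm

/-- The field of endomorphisms which is constant in a parallelism. -/
def constEndo (A : V →L[ℝ] V) (x : M) : TangentSpace I x →L[ℝ] TangentSpace I x :=
  ((θ.equiv x).symm : V →L[ℝ] TangentSpace I x) ∘L A ∘L
    (θ.equiv x : TangentSpace I x →L[ℝ] V)

@[simp]
theorem equiv_constEndo (A : V →L[ℝ] V) (x : M) (v : TangentSpace I x) :
    θ.equiv x (θ.constEndo A x v) = A (θ.equiv x v) :=
  (θ.equiv x).apply_symm_apply _

theorem isSmoothEndo_constEndo [CompleteSpace E] (A : V →L[ℝ] V) :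
    IsSmoothEndo (θ.constEndo A) := by
  intro x
  refine (contMDiffAt_hom_bundle _).2 ⟨contMDiffAt_id, ?_⟩
  refine ((θ.contMDiffAt_inverse_coord x).clm_comp
    ((contMDiffAt_const (c := A)).clm_comp (θ.contMDiffAt_coord x))).congr_of_eventuallyEq ?_
  filter_upwards [eventually_mem_baseSet (I := I) x] with y hy
  ext v
  rw [ContinuousLinearMap.inCoordinates_eq hy hy]
  simp only [ContinuousLinearMap.comp_apply]
  rw [θ.inverse_coord_apply hy]
  simp only [ContinuousLinearEquiv.coe_coe, Trivialization.coe_continuousLinearEquivAt_eq,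
    Trivialization.symm_continuousLinearEquivAt_eq]
  rw [Trivialization.continuousLinearMapAt_apply, Trivialization.coe_linearMapAt_of_mem _ hy]
  rfl

end Parallelism

end Parallelism

section Metric

variable {E : Type*} [NormedAddCommGroup E] [NormedSpace ℝ E]
  {H : Type*} [TopologicalSpace H] {I : ModelWithCorners ℝ E H}
  {M : Type*} [TopologicalSpace M] [ChartedSpace H M] [IsManifold I ∞ M]
  {V : Type*} [NormedAddCommGroup V] [InnerProductSpace ℝ V]
  (θ : Parallelism I M V)

namespace Parallelism

variable [FiniteDimensional ℝ E]

/-- The Riemannian metric for which a parallelism is isometric. -/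
def metric : SmoothMetric I M where
  inner x := (innerSL ℝ : V →L[ℝ] V →L[ℝ] ℝ).bilinearComp (E' := E) (F' := E)
    (θ.equiv x : TangentSpace I x →L[ℝ] V) (θ.equiv x : TangentSpace I x →L[ℝ] V)
  symm x v w := real_inner_comm _ _
  pos x v hv := real_inner_self_pos.2
    fun h ↦ hv ((θ.equiv x).map_eq_zero_iff.1 h)
  isVonNBounded x := by
    refine ((NormedSpace.isVonNBounded_ball ℝ V 1).image
      ((θ.equiv x).symm : V →L[ℝ] TangentSpace I x)).subset fun v hv ↦
      (Set.mem_image _ _ _).2 ⟨θ.equiv x v, ?_, (θ.equiv x).symm_apply_apply v⟩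
    have hv' : inner ℝ (θ.equiv x v) (θ.equiv x v) < 1 := hv
    rw [real_inner_self_eq_norm_sq] at hv'
    rw [mem_ball_zero_iff]
    exact (sq_lt_one_iff₀ (norm_nonneg _)).1 hv'
  contMDiff x := by
    refine (contMDiffAt_hom_bundle _).2 ⟨contMDiffAt_id, ?_⟩
    refine ((contDiff_bilinearComp_self (innerSL ℝ)).contMDiff.contMDiffAt.comp x
      (θ.contMDiffAt_coord x)).congr_of_eventuallyEq ?_
    filter_upwards [eventually_mem_baseSet (I := I) x] with y hy
    ext v w
    refine (inCoordinates_apply_eq₂ hy hy (Set.mem_univ _)).trans ?_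
    simp [coord, Trivialization.symmL_apply _ hy]
    rfl

@[simp]
theorem metric_inner (x : M) (v w : TangentSpace I x) :
    θ.metric.inner x v w = inner ℝ (θ.equiv x v) (θ.equiv x w) := rfl

end Parallelism
end Metric

/-! ### Riemannian distances -/

section Distance

variable {E : Type*} [NormedAddCommGroup E] [NormedSpace ℝ E]
  {H : Type*} [TopologicalSpace H] {I : ModelWithCorners ℝ E H}
  {M : Type*} [TopologicalSpace M] [ChartedSpace H M] [IsManifold I ∞ M]
  {E' : Type*} [NormedAddCommGroup E'] [NormedSpace ℝ E']
  {H' : Type*} [TopologicalSpace H'] {I' : ModelWithCorners ℝ E' H'}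
  {N : Type*} [TopologicalSpace N] [ChartedSpace H' N] [IsManifold I' ∞ N]

namespace SmoothMetric

theorem edist_comm (g : SmoothMetric I M) (x y : M) : g.edist x y = g.edist y x :=
  let : RiemannianBundle (fun x : M ↦ TangentSpace I x) := ⟨g.toRiemannianMetric⟩
  riemannianEDist_comm

theorem edist_triangle (g : SmoothMetric I M) (x y z : M) :
    g.edist x z ≤ g.edist x y + g.edist y z :=
  let : RiemannianBundle (fun x : M ↦ TangentSpace I x) := ⟨g.toRiemannianMetric⟩
  riemannianEDist_triangle

theorem eventually_edist_lt (g : SmoothMetric I M) (x : M) {ε : ℝ≥0∞} (hε : 0 < ε) :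
    ∀ᶠ y in 𝓝 x, g.edist x y < ε := by
  let : RiemannianBundle (fun x : M ↦ TangentSpace I x) := ⟨g.toRiemannianMetric⟩
  have : IsContinuousRiemannianBundle E (fun x : M ↦ TangentSpace I x) :=
    ⟨g.inner, g.contMDiff.continuous, fun _ _ _ ↦ rfl⟩
  exact eventually_riemannianEDist_lt I x hε

theorem exists_edist_lt_subset [RegularSpace M] (g : SmoothMetric I M) {x : M} {s : Set M}
    (hs : s ∈ 𝓝 x) : ∃ c > 0, {y | g.edist x y < c} ⊆ s := by
  let : RiemannianBundle (fun x : M ↦ TangentSpace I x) := ⟨g.toRiemannianMetric⟩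
  have : IsContinuousRiemannianBundle E (fun x : M ↦ TangentSpace I x) :=
    ⟨g.inner, g.contMDiff.continuous, fun _ _ _ ↦ rfl⟩
  exact setOfPred_riemannianEDist_lt_subset_nhds' I hs

/-- A map whose derivative does not increase the norms of tangent vectors does not increase the
Riemannian distance. -/
theorem edist_map_le (g : SmoothMetric I M) (h : SmoothMetric I' N) {f : M → N}
    (hf : ContMDiff I I' 1 f)
    (hgh : ∀ (x : M) (v : TangentSpace I x),
      h.inner (f x) (mfderiv I I' f x v) (mfderiv I I' f x v) ≤ g.inner x v v) (x y : M) :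
    h.edist (f x) (f y) ≤ g.edist x y := by
  let : RiemannianBundle (fun x : M ↦ TangentSpace I x) := ⟨g.toRiemannianMetric⟩
  let : RiemannianBundle (fun x : N ↦ TangentSpace I' x) := ⟨h.toRiemannianMetric⟩
  have hle (x : M) (v : TangentSpace I x) : ‖mfderiv I I' f x v‖ₑ ≤ ‖v‖ₑ := by
    have h1 : ‖mfderiv I I' f x v‖ ^ 2 ≤ ‖v‖ ^ 2 := by
      rw [← real_inner_self_eq_norm_sq, ← real_inner_self_eq_norm_sq]
      exact hgh x v
    have h2 := (sq_le_sq₀ (norm_nonneg _) (norm_nonneg _)).1 h1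
    exact enorm_le_iff_norm_le.2 h2
  change riemannianEDist I' (f x) (f y) ≤ riemannianEDist I x y
  refine le_of_forall_gt fun r hr ↦ ?_
  obtain ⟨γ, h0, h1, hγ, hlen, -⟩ := exists_lt_locally_constant_of_riemannianEDist_lt hr zero_lt_one
  have hfγ : ContMDiff 𝓘(ℝ, ℝ) I' 1 (f ∘ γ) := hf.comp hγ
  refine (riemannianEDist_le_pathELength (hfγ.contMDiffOn (s := Set.Icc 0 1)) (by simp [h0])
    (by simp [h1]) zero_le_one).trans_lt (lt_of_le_of_lt ?_ hlen)
  rw [pathELength_eq_lintegral_mfderiv_Icc, pathELength_eq_lintegral_mfderiv_Icc]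
  refine MeasureTheory.lintegral_mono fun t ↦ ?_
  rw [mfderiv_comp t (hf.mdifferentiable one_ne_zero _) (hγ.mdifferentiable one_ne_zero t)]
  exact hle _ _

/-- A Riemannian metric is complete if there are enough maps which do not increase distances to a
fixed metric. -/
theorem isComplete_of_retract [RegularSpace M] [LocallyCompactSpace M] (g h : SmoothMetric I M)
    (o : M) (T S : M → M → M) (hT : ∀ p, ContMDiff I I 1 (T p)) (hS : ∀ p, Continuous (S p))
    (hTp : ∀ p, T p p = o) (hST : ∀ p q, S p (T p q) = q)
    (hgh : ∀ (p x : M) (v : TangentSpace I x),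
      h.inner (T p x) (mfderiv I I (T p) x v) (mfderiv I I (T p) x v) ≤ g.inner x v v) :
    g.IsComplete := by
  intro u hu
  obtain ⟨K, hK, hKo⟩ := exists_compact_mem_nhds o
  obtain ⟨r, hr, hrK⟩ := h.exists_edist_lt_subset hKo
  obtain ⟨N, hN⟩ := hu r hr
  have hmem : ∀ n, N ≤ n → u n ∈ S (u N) '' K := by
    intro n hn
    refine ⟨T (u N) (u n), hrK ?_, hST _ _⟩
    have := edist_map_le g h (hT (u N)) (hgh (u N)) (u N) (u n)
    rw [hTp] at this
    exact this.trans_lt (hN N n le_rfl hn)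
  obtain ⟨x, -, hx⟩ := (hK.image (hS (u N))).exists_mapClusterPt (f := atTop) (u := u)
    (Filter.le_principal_iff.2 (Filter.mem_map.2 (Filter.eventually_atTop.2 ⟨N, hmem⟩)))
  refine ⟨x, ENNReal.tendsto_nhds_zero.2 fun ε hε ↦ ?_⟩
  obtain ⟨N', hN'⟩ := hu (ε / 2) (ENNReal.half_pos hε.ne')
  obtain ⟨m, hm, hmx⟩ := Filter.frequently_atTop.1
    (hx.frequently (g.eventually_edist_lt x (ENNReal.half_pos hε.ne'))) N'
  filter_upwards [Filter.eventually_ge_atTop N'] with n hn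
  calc g.edist (u n) x ≤ g.edist (u n) (u m) + g.edist (u m) x := g.edist_triangle _ _ _
    _ ≤ ε / 2 + ε / 2 := by
      gcongr
      · exact (hN' n m hn hm).le
      · rw [g.edist_comm]; exact hmx.le
    _ = ε := ENNReal.add_halves ε

end SmoothMetric

end Distance

/-! ### Quaternionic connections -/

section Derivative

variable {E : Type*} [NormedAddCommGroup E] [NormedSpace ℝ E]
  {H : Type*} [TopologicalSpace H] {I : ModelWithCorners ℝ E H}
  {M : Type*} [TopologicalSpace M] [ChartedSpace H M]

theorem mvfderiv_continuousLinearMap_comp {V W : Type*} [NormedAddCommGroup V] [NormedSpace ℝ V]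
    [NormedAddCommGroup W] [NormedSpace ℝ W] (A : V →L[ℝ] W) {f : M → V} {x : M}
    (hf : MDifferentiableAt I 𝓘(ℝ, V) f x) (v : TangentSpace I x) :
    mvfderiv I (fun y ↦ A (f y)) x v = A (mvfderiv I f x v) := by
  have h := mfderiv_comp x (A.contMDiff (n := 1).mdifferentiable one_ne_zero (f x)) hf
  have h2 : mfderiv 𝓘(ℝ, V) 𝓘(ℝ, W) A (f x) = A := by
    rw [mfderiv_eq_fderiv, A.fderiv]
  rw [h2] at h
  exact congr($h v)

theorem mvfderiv_inner {V : Type*} [NormedAddCommGroup V] [InnerProductSpace ℝ V]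
    {f f' : M → V} {x : M} (hf : MDifferentiableAt I 𝓘(ℝ, V) f x)
    (hf' : MDifferentiableAt I 𝓘(ℝ, V) f' x) (v : TangentSpace I x) :
    mvfderiv I (fun y ↦ inner ℝ (f y) (f' y)) x v =
      inner ℝ (mvfderiv I f x v) (f' x) + inner ℝ (f x) (mvfderiv I f' x v) := by
  have h : HasMFDerivAt I 𝓘(ℝ, ℝ) (fun y ↦ inner ℝ (f y) (f' y)) x _ :=
    ⟨(hf.continuousAt.inner hf'.continuousAt), HasFDerivWithinAt.inner ℝ hf.hasMFDerivAt.2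
      hf'.hasMFDerivAt.2⟩
  rw [mvfderiv, ContinuousLinearMap.comp_apply, h.mfderiv]
  refine (add_comm _ _).trans ?_
  simp [extChartAt]
  rfl

end Derivative

section Quaternion

variable {E : Type*} [NormedAddCommGroup E] [NormedSpace ℝ E]
  {H : Type*} [TopologicalSpace H] {I : ModelWithCorners ℝ E H}
  {M : Type*} [TopologicalSpace M] [ChartedSpace H M] [IsManifold I ∞ M]

/-- The imaginary units of the quaternions. -/
def imaginaryUnit (s : Fin 3) : Quaternion ℝ :=
  ⟨0, if s = 0 then 1 else 0, if s = 1 then 1 else 0, if s = 2 then 1 else 0⟩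

@[simp]
theorem re_imaginaryUnit (s : Fin 3) : (imaginaryUnit s).re = 0 := rfl

@[simp]
theorem imI_imaginaryUnit (s : Fin 3) : (imaginaryUnit s).imI = if s = 0 then 1 else 0 := rfl

@[simp]
theorem imJ_imaginaryUnit (s : Fin 3) : (imaginaryUnit s).imJ = if s = 1 then 1 else 0 := rfl

@[simp]
theorem imK_imaginaryUnit (s : Fin 3) : (imaginaryUnit s).imK = if s = 2 then 1 else 0 := rfl

namespace Parallelism

variable (θ : Parallelism I M (Quaternion ℝ))
  (κ : ∀ x : M, TangentSpace I x →L[ℝ] Quaternion ℝ)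

/-- Covariant differentiation of vector fields which, in a parallelism, is given by
`∇_v f = v(f) + f κ(v)`. -/
def quaternionicDerivative (Y : ∀ x : M, TangentSpace I x) (x : M) :
    TangentSpace I x →L[ℝ] TangentSpace I x :=
  ((θ.equiv x).symm : Quaternion ℝ →L[ℝ] TangentSpace I x) ∘L
    (mvfderiv I (fun y ↦ θ.equiv y (Y y)) x +
      (ContinuousLinearMap.mul ℝ (Quaternion ℝ) (θ.equiv x (Y x))) ∘L κ x)

theorem equiv_quaternionicDerivative (Y : ∀ x : M, TangentSpace I x) (x : M)
    (v : TangentSpace I x) :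
    θ.equiv x (θ.quaternionicDerivative κ Y x v) =
      mvfderiv I (fun y ↦ θ.equiv y (Y y)) x v + θ.equiv x (Y x) * κ x v :=
  (θ.equiv x).apply_symm_apply _

/-- The connection on `TM` which, in a parallelism, is given by `∇_v f = v(f) + f κ(v)`. -/
def quaternionicConnection : CovariantDerivative I E (fun x : M ↦ TangentSpace I x) where
  toFun := θ.quaternionicDerivative κ
  isCovariantDerivativeOnUniv :=
    { add := by
        intro Y Z x hY hZ _
        ext v
        apply (θ.equiv x).injective
        have h : (fun y ↦ θ.equiv y ((Y + Z) y)) =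
            (fun y ↦ θ.equiv y (Y y)) + fun y ↦ θ.equiv y (Z y) := by
          ext1 y; exact map_add _ _ _
        rw [_root_.add_apply, map_add]
        simp only [equiv_quaternionicDerivative]
        rw [h, mvfderiv_add (θ.mdifferentiableAt_equiv_apply hY)
          (θ.mdifferentiableAt_equiv_apply hZ)]
        rw [_root_.add_apply, Pi.add_apply, map_add, add_mul]
        abel
      leibniz := by
        intro Y f x hY hf _
        ext v
        apply (θ.equiv x).injective
        have h : (fun y ↦ θ.equiv y ((f • Y) y)) = f • fun y ↦ θ.equiv y (Y y) := by
          ext1 y; exact map_smul _ _ _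
        rw [_root_.add_apply, map_add, _root_.smul_apply, map_smul,
          ContinuousLinearMap.smulRight_apply, map_smul]
        simp only [equiv_quaternionicDerivative]
        rw [h, mvfderiv_smul hf (θ.mdifferentiableAt_equiv_apply hY)]
        rw [_root_.add_apply, _root_.smul_apply, ContinuousLinearMap.smulRight_apply,
          Pi.smul_apply', map_smul, smul_mul_assoc, smul_add]
        abel }

theorem quaternionicConnection_apply (Y : ∀ x : M, TangentSpace I x) (x : M)
    (v : TangentSpace I x) :
    θ.equiv x (θ.quaternionicConnection κ Y x v) =
      mvfderiv I (fun y ↦ θ.equiv y (Y y)) x v + θ.equiv x (Y x) * κ x v :=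
  θ.equiv_quaternionicDerivative κ Y x v

theorem isCompatible_quaternionicConnection [FiniteDimensional ℝ E] (hκ : ∀ x v, (κ x v).re = 0) :
    θ.metric.IsCompatible (θ.quaternionicConnection κ) := by
  intro Y Z x hY hZ v
  simp only [metric_inner, quaternionicConnection_apply]
  rw [mvfderiv_inner (θ.mdifferentiableAt_equiv_apply hY) (θ.mdifferentiableAt_equiv_apply hZ)]
  have h : inner ℝ (θ.equiv x (Y x) * κ x v) (θ.equiv x (Z x)) +
      inner ℝ (θ.equiv x (Y x)) (θ.equiv x (Z x) * κ x v) = 0 := by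
    simp only [Quaternion.inner_def, Quaternion.re_mul, Quaternion.imI_mul, Quaternion.imJ_mul,
      Quaternion.imK_mul, Quaternion.re_star, Quaternion.imI_star,
      Quaternion.imJ_star, Quaternion.imK_star, hκ]
    ring
  rw [inner_add_left, inner_add_right]
  linear_combination -h

/-- Left multiplication by a quaternion in a parallelism. -/
def leftMul (q : Quaternion ℝ) : ∀ x : M, TangentSpace I x →L[ℝ] TangentSpace I x :=
  θ.constEndo (ContinuousLinearMap.mul ℝ (Quaternion ℝ) q)

@[simp]
theorem equiv_leftMul (q : Quaternion ℝ) (x : M) (v : TangentSpace I x) :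
    θ.equiv x (θ.leftMul q x v) = q * θ.equiv x v :=
  θ.equiv_constEndo _ x v

theorem isParallelEndo_leftMul (q : Quaternion ℝ) :
    IsParallelEndo (θ.quaternionicConnection κ) (θ.leftMul q) := by
  intro Y x hY v
  apply (θ.equiv x).injective
  simp only [quaternionicConnection_apply, equiv_leftMul]
  rw [mul_add, ← mul_assoc]
  congr 1
  exact mvfderiv_continuousLinearMap_comp (ContinuousLinearMap.mul ℝ (Quaternion ℝ) q)
    (θ.mdifferentiableAt_equiv_apply hY) v

theorem isHyperKahler_metric [FiniteDimensional ℝ E] (hκ : ∀ x v, (κ x v).re = 0)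
    (h : (θ.quaternionicConnection κ).torsion = 0) : θ.metric.IsHyperKahler := by
  refine ⟨fun s ↦ θ.leftMul (imaginaryUnit s), ⟨fun s ↦ ?_, fun s x v ↦ ?_, fun x v ↦ ?_,
    fun x v ↦ ?_⟩, fun s x v w ↦ ?_, θ.quaternionicConnection κ,
    ⟨h, θ.isCompatible_quaternionicConnection κ hκ⟩, fun s ↦ θ.isParallelEndo_leftMul κ _⟩
  · exact θ.isSmoothEndo_constEndo _
  · apply (θ.equiv x).injective
    rw [map_neg, equiv_leftMul, equiv_leftMul, ← mul_assoc]
    fin_cases s <;> ext <;> simp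
  · apply (θ.equiv x).injective
    simp only [equiv_leftMul, ← mul_assoc]
    congr 1
    ext <;> simp
  · apply (θ.equiv x).injective
    rw [map_neg]
    simp only [equiv_leftMul, ← mul_assoc, ← neg_mul]
    congr 1
    ext <;> simp
  · simp only [metric_inner, equiv_leftMul, Quaternion.inner_def]
    fin_cases s <;> simp <;> ring

end Parallelism

end Quaternion

/-! ### Hyper-Kähler metrics with diagonal coefficients: the differential equations -/

/-- The functions `f₁, f₂, f₃` satisfy `(fⱼ fₖ)' = -bᵢ f₀ fᵢ` for cyclic `i, j, k`. -/
structure IsDiagonalSolution (b : Fin 3 → ℝ) (f₀ f₁ f₂ f₃ : ℝ → ℝ) : Prop where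
  contDiff₀ : ContDiff ℝ ∞ f₀
  contDiff₁ : ContDiff ℝ ∞ f₁
  contDiff₂ : ContDiff ℝ ∞ f₂
  contDiff₃ : ContDiff ℝ ∞ f₃
  pos₀ (s : ℝ) : 0 < f₀ s
  pos₁ (s : ℝ) : 0 < f₁ s
  pos₂ (s : ℝ) : 0 < f₂ s
  pos₃ (s : ℝ) : 0 < f₃ s
  eq₁ (s : ℝ) : deriv f₂ s * f₃ s + f₂ s * deriv f₃ s = -b 0 * f₀ s * f₁ s
  eq₂ (s : ℝ) : deriv f₃ s * f₁ s + f₃ s * deriv f₁ s = -b 1 * f₀ s * f₂ s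
  eq₃ (s : ℝ) : deriv f₁ s * f₂ s + f₁ s * deriv f₂ s = -b 2 * f₀ s * f₃ s

theorem sqrt_div_mul_sqrt_div {x y z : ℝ} (hx : 0 < x) (hy : 0 < y) (hz : 0 < z) :
    √(x * y / z) * √(y * z / x) = y := by
  rw [← Real.sqrt_mul (by positivity)]
  rw [show x * y / z * (y * z / x) = y ^ 2 by field_simp]
  exact Real.sqrt_sq hy.le

theorem sqrt_mul_sqrt_div {x y z : ℝ} (hx : 0 < x) (hy : 0 < y) (hz : 0 < z) :
    √(x * y * z) * √(y * z / x) = y * z := by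
  rw [← Real.sqrt_mul (by positivity)]
  rw [show x * y * z * (y * z / x) = (y * z) ^ 2 by field_simp]
  exact Real.sqrt_sq (by positivity)

theorem contDiff_sqrt_div {u v w : ℝ → ℝ} (hu : ContDiff ℝ ∞ u) (hv : ContDiff ℝ ∞ v)
    (hw : ContDiff ℝ ∞ w) (pu : ∀ s, 0 < u s) (pv : ∀ s, 0 < v s) (pw : ∀ s, 0 < w s) :
    ContDiff ℝ ∞ (fun s ↦ √(u s * v s / w s)) :=
  ((hu.mul hv).div hw fun s ↦ (pw s).ne').sqrt fun s ↦
    (div_pos (mul_pos (pu s) (pv s)) (pw s)).ne'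

/-- The solutions of the diagonal equations are obtained from those of the Euler equations
`wᵢ' = -bᵢ p wⱼ wₖ`. -/
theorem exists_isDiagonalSolution_of_euler (b : Fin 3 → ℝ) {p w₁ w₂ w₃ : ℝ → ℝ}
    (hp : ContDiff ℝ ∞ p) (h₁ : ContDiff ℝ ∞ w₁) (h₂ : ContDiff ℝ ∞ w₂) (h₃ : ContDiff ℝ ∞ w₃)
    (pp : ∀ s, 0 < p s) (p₁ : ∀ s, 0 < w₁ s) (p₂ : ∀ s, 0 < w₂ s) (p₃ : ∀ s, 0 < w₃ s)
    (e₁ : ∀ s, HasDerivAt w₁ (-b 0 * p s * w₂ s * w₃ s) s)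
    (e₂ : ∀ s, HasDerivAt w₂ (-b 1 * p s * w₃ s * w₁ s) s)
    (e₃ : ∀ s, HasDerivAt w₃ (-b 2 * p s * w₁ s * w₂ s) s) :
    ∃ f₀ f₁ f₂ f₃, IsDiagonalSolution b f₀ f₁ f₂ f₃ := by
  have c₁ := contDiff_sqrt_div h₂ h₃ h₁ p₂ p₃ p₁
  have c₂ := contDiff_sqrt_div h₃ h₁ h₂ p₃ p₁ p₂
  have c₃ := contDiff_sqrt_div h₁ h₂ h₃ p₁ p₂ p₃
  have d₁ s := (c₁.differentiable (by simp) s).hasDerivAt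
  have d₂ s := (c₂.differentiable (by simp) s).hasDerivAt
  have d₃ s := (c₃.differentiable (by simp) s).hasDerivAt
  refine ⟨fun s ↦ p s * √(w₁ s * w₂ s * w₃ s), _, _, _, hp.mul (((h₁.mul h₂).mul h₃).sqrt
    fun s ↦ (mul_pos (mul_pos (p₁ s) (p₂ s)) (p₃ s)).ne'), c₁, c₂, c₃, fun s ↦ ?_, fun s ↦ ?_,
    fun s ↦ ?_, fun s ↦ ?_, fun s ↦ ?_, fun s ↦ ?_, fun s ↦ ?_⟩
  · have := pp s; have := p₁ s; have := p₂ s; have := p₃ s; positivity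
  · have := p₁ s; have := p₂ s; have := p₃ s; positivity
  · have := p₁ s; have := p₂ s; have := p₃ s; positivity
  · have := p₁ s; have := p₂ s; have := p₃ s; positivity
  · have h := ((d₂ s).mul (d₃ s)).congr_of_eventuallyEq (f₁ := w₁) (.of_forall fun r ↦
      (sqrt_div_mul_sqrt_div (p₃ r) (p₁ r) (p₂ r)).symm)
    rw [h.unique (e₁ s)]
    linear_combination b 0 * p s * sqrt_mul_sqrt_div (p₁ s) (p₂ s) (p₃ s)
  · have h := ((d₃ s).mul (d₁ s)).congr_of_eventuallyEq (f₁ := w₂) (.of_forall fun r ↦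
      (sqrt_div_mul_sqrt_div (p₁ r) (p₂ r) (p₃ r)).symm)
    rw [h.unique (e₂ s)]
    have := sqrt_mul_sqrt_div (p₂ s) (p₃ s) (p₁ s)
    rw [show w₂ s * w₃ s * w₁ s = w₁ s * w₂ s * w₃ s by ring] at this
    linear_combination b 1 * p s * this
  · have h := ((d₁ s).mul (d₂ s)).congr_of_eventuallyEq (f₁ := w₃) (.of_forall fun r ↦
      (sqrt_div_mul_sqrt_div (p₂ r) (p₃ r) (p₁ r)).symm)
    rw [h.unique (e₃ s)]
    have := sqrt_mul_sqrt_div (p₃ s) (p₁ s) (p₂ s)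
    rw [show w₃ s * w₁ s * w₂ s = w₁ s * w₂ s * w₃ s by ring] at this
    linear_combination b 2 * p s * this

/-- Two functions `c, d` with `c' = -d² c` and `d' = d c²`. -/
theorem exists_hyperbolic_pair : ∃ c d : ℝ → ℝ, ContDiff ℝ ∞ c ∧ ContDiff ℝ ∞ d ∧
    (∀ s, 0 < c s) ∧ (∀ s, 0 < d s) ∧ (∀ s, HasDerivAt c (-(d s ^ 2 * c s)) s) ∧
      ∀ s, HasDerivAt d (d s * c s ^ 2) s := by
  have hpos (s : ℝ) : 0 < 1 + Real.exp (2 * s) := by positivity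
  have hc : ContDiff ℝ ∞ (fun s : ℝ ↦ (√(1 + Real.exp (2 * s)))⁻¹) := by
    refine ContDiff.inv (ContDiff.sqrt (by fun_prop) fun s ↦ (hpos s).ne') fun s ↦ ?_
    exact (Real.sqrt_pos.2 (hpos s)).ne'
  have hsq (s : ℝ) : ((√(1 + Real.exp (2 * s)))⁻¹) ^ 2 = (1 + Real.exp (2 * s))⁻¹ := by
    rw [inv_pow, Real.sq_sqrt (hpos s).le]
  have h1 (s : ℝ) : HasDerivAt (fun s : ℝ ↦ (√(1 + Real.exp (2 * s)))⁻¹)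
      (-((Real.exp s * (√(1 + Real.exp (2 * s)))⁻¹) ^ 2 * (√(1 + Real.exp (2 * s)))⁻¹)) s := by
    have h := ((((hasDerivAt_id s).const_mul 2).exp.const_add 1).sqrt (hpos s).ne').inv
      (Real.sqrt_pos.2 (hpos s)).ne'
    refine h.congr_deriv ?_
    have h3 : Real.exp (2 * s) = Real.exp s ^ 2 := by rw [← Real.exp_nat_mul]; norm_num
    simp only [id]
    rw [h3]
    field_simp
  refine ⟨_, fun s ↦ Real.exp s * (√(1 + Real.exp (2 * s)))⁻¹, hc, Real.contDiff_exp.mul hc,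
    fun s ↦ inv_pos.2 (Real.sqrt_pos.2 (hpos s)), fun s ↦ mul_pos (Real.exp_pos s)
      (inv_pos.2 (Real.sqrt_pos.2 (hpos s))), h1, fun s ↦ ?_⟩
  refine ((Real.hasDerivAt_exp s).mul (h1 s)).congr_deriv ?_
  have h3 : Real.exp (2 * s) = Real.exp s ^ 2 := by rw [← Real.exp_nat_mul]; norm_num
  have h4 := hsq s
  have h5 : ((√(1 + Real.exp (2 * s)))⁻¹) ^ 2 * (1 + Real.exp s ^ 2) = 1 := by
    rw [h4, ← h3, inv_mul_cancel₀ (hpos s).ne']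
  linear_combination -(Real.exp s * (√(1 + Real.exp (2 * s)))⁻¹) * h5

theorem exists_isDiagonalSolution (t : BianchiA) :
    ∃ f₀ f₁ f₂ f₃, IsDiagonalSolution t.b f₀ f₁ f₂ f₃ := by
  obtain ⟨c, d, hc, hd, pc, pd, ec, ed⟩ := exists_hyperbolic_pair
  have hone : ContDiff ℝ ∞ (fun _ : ℝ ↦ (1 : ℝ)) := contDiff_const
  have pone (s : ℝ) : (0 : ℝ) < (fun _ : ℝ ↦ (1 : ℝ)) s := one_pos
  have eone (s : ℝ) : HasDerivAt (fun _ : ℝ ↦ (1 : ℝ)) 0 s := hasDerivAt_const s 1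
  have hn : ContDiff ℝ ∞ (fun s : ℝ ↦ Real.exp (-s)) := by fun_prop
  have pn (s : ℝ) : 0 < (fun s : ℝ ↦ Real.exp (-s)) s := Real.exp_pos _
  have en (s : ℝ) : HasDerivAt (fun s : ℝ ↦ Real.exp (-s)) (-Real.exp (-s)) s := by
    simpa using (hasDerivAt_neg s).exp
  cases t
  · refine exists_isDiagonalSolution_of_euler _ hone hone hone hone pone pone pone pone
      ?_ ?_ ?_ <;> refine fun s ↦ (eone s).congr_deriv ?_ <;> simp [BianchiA.b]
  · refine exists_isDiagonalSolution_of_euler _ hn hone hone hn pn pone pone pn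
      (fun s ↦ (eone s).congr_deriv ?_) (fun s ↦ (eone s).congr_deriv ?_)
      (fun s ↦ (en s).congr_deriv ?_) <;> simp [BianchiA.b]
  · refine exists_isDiagonalSolution_of_euler _ (hc.mul hd) hone hc hd
      (fun s ↦ mul_pos (pc s) (pd s)) pone pc pd
      (fun s ↦ (eone s).congr_deriv ?_) (fun s ↦ (ec s).congr_deriv ?_)
      (fun s ↦ (ed s).congr_deriv ?_) <;> simp [BianchiA.b] <;> ring
  · refine exists_isDiagonalSolution_of_euler _ hone hone hn hn pone pone pn pn
      (fun s ↦ (eone s).congr_deriv ?_) (fun s ↦ (en s).congr_deriv ?_)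
      (fun s ↦ (en s).congr_deriv ?_) <;> simp [BianchiA.b]
  · refine exists_isDiagonalSolution_of_euler _ hd hc hc hd pd pc pc pd
      (fun s ↦ (ec s).congr_deriv ?_) (fun s ↦ (ec s).congr_deriv ?_)
      (fun s ↦ (ed s).congr_deriv ?_) <;> simp [BianchiA.b] <;>
      first | ring1 | (left; ring1)
  · refine exists_isDiagonalSolution_of_euler _ Real.contDiff_exp hn hn hn Real.exp_pos pn pn pn
      ?_ ?_ ?_ <;> refine fun s ↦ (en s).congr_deriv ?_ <;>
      simp [BianchiA.b, ← Real.exp_add]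

namespace Parallelism

variable {E : Type*} [NormedAddCommGroup E] [NormedSpace ℝ E]
  {H : Type*} [TopologicalSpace H] {I : ModelWithCorners ℝ E H}
  {M : Type*} [TopologicalSpace M] [ChartedSpace H M] [IsManifold I ∞ M]
  {V : Type*} [NormedAddCommGroup V] [NormedSpace ℝ V]
  {W : Type*} [NormedAddCommGroup W] [NormedSpace ℝ W]

/-- A parallelism followed by a smooth family of linear isomorphisms. -/
def postcomp (θ : Parallelism I M V) (D : M → V ≃L[ℝ] W)
    (hD : ContMDiff I 𝓘(ℝ, V →L[ℝ] W) ∞ (fun x ↦ (D x : V →L[ℝ] W))) : Parallelism I M W where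
  equiv x := (θ.equiv x).trans (D x)
  smooth x₀ := (hD x₀).clm_comp (θ.smooth x₀)

end Parallelism

section Diagonal

variable {E : Type*} [NormedAddCommGroup E] [NormedSpace ℝ E]
  {H : Type*} [TopologicalSpace H] {I : ModelWithCorners ℝ E H}
  {M : Type*} [TopologicalSpace M] [ChartedSpace H M] [IsManifold I ∞ M]
  {E' : Type*} [NormedAddCommGroup E'] [NormedSpace ℝ E']
  {H' : Type*} [TopologicalSpace H'] {I' : ModelWithCorners ℝ E' H'}
  {N : Type*} [TopologicalSpace N] [ChartedSpace H' N] [IsManifold I' ∞ N]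

theorem inCoordinates_tangentSpace_of_eq {x₀ x : M}
    (hx : x ∈ (trivializationAt E (TangentSpace I : M → Type _) x₀).baseSet) {y z : N} (h : y = z)
    (A : E →L[ℝ] E') :
    ContinuousLinearMap.inCoordinates E (TangentSpace I) E' (TangentSpace I') x₀ x z y A =
      A ∘L (trivializationAt E (TangentSpace I) x₀).symmL ℝ x := by
  subst h
  refine (ContinuousLinearMap.inCoordinates_eq hx
    (FiberBundle.mem_baseSet_trivializationAt' y)).trans ?_
  have hy (w : TangentSpace I' y) :
      (trivializationAt E' (TangentSpace I') y).continuousLinearEquivAt ℝ y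
        (FiberBundle.mem_baseSet_trivializationAt' y) w = w :=
    (congr($(Trivialization.coe_continuousLinearEquivAt_eq (R := ℝ) _
      (FiberBundle.mem_baseSet_trivializationAt' y)) w)).trans <|
    (congr($(TangentBundle.continuousLinearMapAt_trivializationAt_eq_core (𝕜 := ℝ) (I := I')
      (mem_chart_source H' y)) w)).trans <|
    (tangentBundleCore I' N).coordChange_self _ _ (mem_achart_source H' y) _
  ext v
  exact (hy _).trans
    congr(A ($(Trivialization.symm_continuousLinearEquivAt_eq (R := ℝ)
      (trivializationAt E (TangentSpace I) x₀) hx) v))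

/-- The derivatives along the diagonal of a map `f : M × M → N` which is constant on the
diagonal depend smoothly on the point. -/
theorem contMDiffAt_mfderiv_diagonal {f : M → M → N}
    (hf : ContMDiff (I.prod I) I' ∞ (Function.uncurry f)) (hf' : ∀ x y, f x x = f y y)
    (A : M → E →L[ℝ] E') (hA : ∀ x, A x = mfderiv I I' (f x) x) (x₀ : M) :
    ContMDiffAt I 𝓘(ℝ, E →L[ℝ] E') ∞
      (fun x ↦ A x ∘L (trivializationAt E (TangentSpace I) x₀).symmL ℝ x) x₀ := by
  refine (ContMDiffAt.mfderiv f id (hf.contMDiffAt (x := (x₀, x₀))) contMDiffAt_id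
    (m := ∞) (by simp)).congr_of_eventuallyEq ?_
  filter_upwards [Parallelism.eventually_mem_baseSet (I := I) x₀] with x hx
  rw [hA]
  exact (inCoordinates_tangentSpace_of_eq hx (hf' x x₀) _).symm

end Diagonal

section LeftTranslation

variable {G : Type*} [Group G]

/-- Left translation in the group `G × ℝ`. -/
def leftTranslate (p q : G × ℝ) : G × ℝ := (p.1 * q.1, q.2 + p.2)

/-- Left division in the group `G × ℝ`. -/
def leftDiv (p q : G × ℝ) : G × ℝ := (p.1⁻¹ * q.1, q.2 - p.2)

theorem leftDiv_self (p : G × ℝ) : leftDiv p p = (1, 0) := by simp [leftDiv]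

theorem leftTranslate_one (p : G × ℝ) : leftTranslate p (1, 0) = p := by simp [leftTranslate]

theorem leftDiv_leftDiv (p q r : G × ℝ) : leftDiv (leftDiv p q) (leftDiv p r) = leftDiv q r := by
  simp [leftDiv, mul_assoc]

theorem leftTranslate_leftDiv (p q : G × ℝ) : leftTranslate p (leftDiv p q) = q := by
  simp [leftDiv, leftTranslate]

theorem leftDiv_leftTranslate (p q : G × ℝ) : leftDiv p (leftTranslate p q) = q := by
  simp [leftDiv, leftTranslate]

end LeftTranslation

section Group

open VectorField

variable {E : Type*} [NormedAddCommGroup E] [NormedSpace ℝ E]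
  {H : Type*} [TopologicalSpace H] (I : ModelWithCorners ℝ E H)
  {G : Type*} [TopologicalSpace G] [ChartedSpace H G] [Group G] [LieGroup I ∞ G]

theorem contMDiff_uncurry_leftDiv :
    ContMDiff ((I.prod 𝓘(ℝ, ℝ)).prod (I.prod 𝓘(ℝ, ℝ))) (I.prod 𝓘(ℝ, ℝ)) ∞
      (Function.uncurry (leftDiv (G := G))) :=
  ((contMDiff_fst.comp contMDiff_fst).inv.mul (contMDiff_fst.comp contMDiff_snd)).prodMk
    ((contMDiff_snd.comp contMDiff_snd).sub (contMDiff_snd.comp contMDiff_fst))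

theorem contMDiff_leftDiv (p : G × ℝ) :
    ContMDiff (I.prod 𝓘(ℝ, ℝ)) (I.prod 𝓘(ℝ, ℝ)) ∞ (leftDiv p) :=
  (contMDiff_uncurry_leftDiv I).comp (contMDiff_const.prodMk contMDiff_id)

theorem contMDiff_leftTranslate (p : G × ℝ) :
    ContMDiff (I.prod 𝓘(ℝ, ℝ)) (I.prod 𝓘(ℝ, ℝ)) ∞ (leftTranslate p) :=
  (contMDiff_const.mul contMDiff_fst).prodMk (contMDiff_snd.add contMDiff_const)

theorem mfderiv_leftTranslate_one (p : G × ℝ) (u : E × ℝ) :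
    (mfderiv (I.prod 𝓘(ℝ, ℝ)) (I.prod 𝓘(ℝ, ℝ)) (leftTranslate p) (1, 0) u : E × ℝ) =
      ((mulInvariantVectorField (I := I) (u.1 : GroupLieAlgebra I G) p.1 : E), u.2) := by
  have h1 : MDifferentiableAt I I (p.1 * ·) (1 : G) :=
    (contMDiff_mul_left (I := I) (n := ∞)).mdifferentiable (by simp) _
  have h2 : HasMFDerivAt 𝓘(ℝ, ℝ) 𝓘(ℝ, ℝ) (· + p.2) (0 : ℝ) (.id ℝ ℝ) :=
    ((hasFDerivAt_id (0 : ℝ)).add_const p.2).hasMFDerivAt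
  have h := mfderiv_prodMap (p := ((1 : G), (0 : ℝ))) h1 h2.mdifferentiableAt
  rw [h2.mfderiv] at h
  exact congr($h u)

theorem mfderiv_leftDiv_mfderiv_leftTranslate (p q : G × ℝ) {r : G × ℝ}
    (hr : r = leftTranslate p q) (u : E × ℝ) :
    (mfderiv (I.prod 𝓘(ℝ, ℝ)) (I.prod 𝓘(ℝ, ℝ)) (leftDiv p) r
      (mfderiv (I.prod 𝓘(ℝ, ℝ)) (I.prod 𝓘(ℝ, ℝ)) (leftTranslate p) q u : E × ℝ) : E × ℝ) = u := by
  subst hr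
  have h := mfderiv_comp q ((contMDiff_leftDiv I p).mdifferentiable (by simp) _)
    ((contMDiff_leftTranslate I p).mdifferentiable (by simp) q)
  rw [show leftDiv p ∘ leftTranslate p = id from funext (leftDiv_leftTranslate p),
    mfderiv_id] at h
  exact congr($h u).symm

theorem mfderiv_leftTranslate_mfderiv_leftDiv (p q : G × ℝ) {r : G × ℝ}
    (hr : r = leftDiv p q) (u : E × ℝ) :
    (mfderiv (I.prod 𝓘(ℝ, ℝ)) (I.prod 𝓘(ℝ, ℝ)) (leftTranslate p) r
      (mfderiv (I.prod 𝓘(ℝ, ℝ)) (I.prod 𝓘(ℝ, ℝ)) (leftDiv p) q u : E × ℝ) : E × ℝ) = u := by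
  subst hr
  have h := mfderiv_comp q ((contMDiff_leftTranslate I p).mdifferentiable (by simp) _)
    ((contMDiff_leftDiv I p).mdifferentiable (by simp) q)
  rw [show leftTranslate p ∘ leftDiv p = id from funext (leftTranslate_leftDiv p),
    mfderiv_id] at h
  exact congr($h u).symm

variable (G) in
/-- The left invariant parallelism of the group `G × ℝ`. -/
def leftParallelism : Parallelism (I.prod 𝓘(ℝ, ℝ)) (G × ℝ) (E × ℝ) where
  equiv p := ContinuousLinearEquiv.equivOfInverse
    (M₁ := TangentSpace (I.prod 𝓘(ℝ, ℝ)) p) (M₂ := E × ℝ)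
    (mfderiv (I.prod 𝓘(ℝ, ℝ)) (I.prod 𝓘(ℝ, ℝ)) (leftDiv p) p : _ →L[ℝ] _)
    (mfderiv (I.prod 𝓘(ℝ, ℝ)) (I.prod 𝓘(ℝ, ℝ)) (leftTranslate p) (1, 0) : _ →L[ℝ] _)
    (fun v ↦ mfderiv_leftTranslate_mfderiv_leftDiv I p p (leftDiv_self p).symm v)
    (fun u ↦ mfderiv_leftDiv_mfderiv_leftTranslate I p (1, 0) (leftTranslate_one p).symm u)
  smooth := contMDiffAt_mfderiv_diagonal (contMDiff_uncurry_leftDiv I)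
    (fun x y ↦ by rw [leftDiv_self, leftDiv_self]) _ fun x ↦ rfl

theorem leftParallelism_mfderiv_leftDiv (p q : G × ℝ)
    (v : TangentSpace (I.prod 𝓘(ℝ, ℝ)) q) :
    (leftParallelism I G).equiv (leftDiv p q)
      (mfderiv (I.prod 𝓘(ℝ, ℝ)) (I.prod 𝓘(ℝ, ℝ)) (leftDiv p) q v) =
    (leftParallelism I G).equiv q v := by
  have h := mfderiv_comp q ((contMDiff_leftDiv I (leftDiv p q)).mdifferentiable (by simp) _)
    ((contMDiff_leftDiv I p).mdifferentiable (by simp) q)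
  rw [show leftDiv (leftDiv p q) ∘ leftDiv p = leftDiv q from funext (leftDiv_leftDiv p q)] at h
  exact congr($h v).symm

theorem constField_leftParallelism (u : E × ℝ) (p : G × ℝ) :
    ((leftParallelism I G).constField u p : E × ℝ) =
      ((mulInvariantVectorField (I := I) (u.1 : GroupLieAlgebra I G) p.1 : E), u.2) :=
  mfderiv_leftTranslate_one I p u

theorem mlieBracket_constField_leftParallelism [CompleteSpace E] [BoundarylessManifold I G]
    [I.Boundaryless] (u v : GroupLieAlgebra I G) (s t : ℝ) (p : G × ℝ) :
    mlieBracket (I.prod 𝓘(ℝ, ℝ)) ((leftParallelism I G).constField (u, s))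
      ((leftParallelism I G).constField (v, t)) p =
    (leftParallelism I G).constField ((⁅u, v⁆ : GroupLieAlgebra I G), 0) p := by
  have dX := (leftParallelism I G).vectorFieldDiffAt_constField (u, s) p
  have dY := (leftParallelism I G).vectorFieldDiffAt_constField (v, t) p
  have hfst := mfderiv_mlieBracket_of_related (φ := (Prod.fst : G × ℝ → G))
    (contMDiff_fst (I := I) (J := 𝓘(ℝ, ℝ)) (n := 2)) dX dY
    (mdifferentiableAt_mulInvariantVectorField u)
    (mdifferentiableAt_mulInvariantVectorField v)
    (fun y ↦ by
      rw [mfderiv_fst]; exact congr(($(constField_leftParallelism I (u, s) y)).1))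
    (fun y ↦ by
      rw [mfderiv_fst]; exact congr(($(constField_leftParallelism I (v, t) y)).1))
  have hconst (c y : ℝ) : VectorFieldDiffAt (I := 𝓘(ℝ, ℝ)) (fun _ ↦ (c : ℝ)) y := by
    refine (mdifferentiableAt_totalSpace _ _).2 ⟨mdifferentiableAt_id, ?_⟩
    simp
    exact mdifferentiableAt_const
  have hsnd := mfderiv_mlieBracket_of_related (φ := (Prod.snd : G × ℝ → ℝ))
    (contMDiff_snd (I := I) (J := 𝓘(ℝ, ℝ)) (n := 2)) dX dY
    (hconst s p.2) (hconst t p.2)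
    (fun y ↦ by
      rw [mfderiv_snd]; exact congr(($(constField_leftParallelism I (u, s) y)).2))
    (fun y ↦ by
      rw [mfderiv_snd]; exact congr(($(constField_leftParallelism I (v, t) y)).2))
  have hzero : mlieBracket 𝓘(ℝ, ℝ) (fun _ : ℝ ↦ (s : ℝ)) (fun _ : ℝ ↦ (t : ℝ)) p.2 =
      (0 : ℝ) := by
    have h (V W : ∀ x : ℝ, TangentSpace 𝓘(ℝ, ℝ) x) :
        mlieBracket 𝓘(ℝ, ℝ) V W p.2 = lieBracketWithin ℝ V W Set.univ p.2 := by
      rw [← mlieBracketWithin_univ, mlieBracketWithin_eq_lieBracketWithin]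
    refine (h _ _).trans ?_
    simp [lieBracketWithin]
    rfl
  have hbr : mlieBracket I (mulInvariantVectorField u) (mulInvariantVectorField v) p.1 =
      mulInvariantVectorField ⁅u, v⁆ p.1 := by
    rw [GroupLieAlgebra.bracket_def, mulInvariantVector_mlieBracket]
  rw [mfderiv_fst] at hfst
  rw [mfderiv_snd] at hsnd
  refine Eq.trans ?_ (constField_leftParallelism I _ p).symm
  exact Prod.ext (hfst.trans hbr) (hsnd.trans hzero)

end Group

/-! ### Diagonal maps of the quaternions -/

/-- Multiplication of the four coordinates of a quaternion by real numbers. -/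
def quaternionDiag : (Fin 4 → ℝ) →L[ℝ] Quaternion ℝ →L[ℝ] Quaternion ℝ :=
  LinearMap.toContinuousLinearMap
    { toFun a := LinearMap.toContinuousLinearMap
        { toFun q := ⟨a 0 * q.re, a 1 * q.imI, a 2 * q.imJ, a 3 * q.imK⟩
          map_add' q r := by ext <;> exact mul_add _ _ _
          map_smul' c q := by ext <;> exact mul_left_comm _ _ _ }
      map_add' a b := by ext q <;> exact add_mul _ _ _
      map_smul' c a := by ext q <;> exact mul_assoc _ _ _ }

@[simp]
theorem re_quaternionDiag (a : Fin 4 → ℝ) (q : Quaternion ℝ) :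
    (quaternionDiag a q).re = a 0 * q.re := rfl

@[simp]
theorem imI_quaternionDiag (a : Fin 4 → ℝ) (q : Quaternion ℝ) :
    (quaternionDiag a q).imI = a 1 * q.imI := rfl

@[simp]
theorem imJ_quaternionDiag (a : Fin 4 → ℝ) (q : Quaternion ℝ) :
    (quaternionDiag a q).imJ = a 2 * q.imJ := rfl

@[simp]
theorem imK_quaternionDiag (a : Fin 4 → ℝ) (q : Quaternion ℝ) :
    (quaternionDiag a q).imK = a 3 * q.imK := rfl

/-- Multiplication of the four coordinates of a quaternion by nonzero real numbers. -/
def quaternionDiagEquiv (a : Fin 4 → ℝ) (ha : ∀ i, 0 < a i) : Quaternion ℝ ≃L[ℝ] Quaternion ℝ :=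
  ContinuousLinearEquiv.equivOfInverse (quaternionDiag a) (quaternionDiag a⁻¹)
    (fun q ↦ by ext <;> simp [(ha _).ne'])
    (fun q ↦ by ext <;> simp [(ha _).ne'])

theorem inner_self_le_inner_quaternionDiag {a : Fin 4 → ℝ} (ha : ∀ i, 1 ≤ a i)
    (q : Quaternion ℝ) :
    inner ℝ q q ≤ inner ℝ (quaternionDiag a q) (quaternionDiag a q) := by
  have h (i : Fin 4) (x : ℝ) : x * x ≤ a i * x * (a i * x) := by
    nlinarith [mul_self_nonneg x, mul_nonneg (mul_self_nonneg x) (sub_nonneg.2 (ha i)), ha i,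
      mul_nonneg (mul_self_nonneg x) (mul_nonneg (sub_nonneg.2 (ha i)) (sub_nonneg.2 (ha i)))]
  simp only [Quaternion.inner_def, Quaternion.re_mul, Quaternion.re_star, Quaternion.imI_star,
    Quaternion.imJ_star, Quaternion.imK_star, re_quaternionDiag, imI_quaternionDiag,
    imJ_quaternionDiag, imK_quaternionDiag]
  linarith [h 0 q.re, h 1 q.imI, h 2 q.imJ, h 3 q.imK]

theorem inner_quaternionDiag_smul (c : ℝ) (a : Fin 4 → ℝ) (q r : Quaternion ℝ) :
    inner ℝ (quaternionDiag (c • a) q) (quaternionDiag (c • a) r) =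
      c ^ 2 * inner ℝ (quaternionDiag a q) (quaternionDiag a r) := by
  have h (q : Quaternion ℝ) : quaternionDiag (c • a) q = c • quaternionDiag a q := by
    ext <;> exact mul_assoc _ _ _
  rw [h, h, real_inner_smul_left, real_inner_smul_right]
  ring

/-- The quaternionic coordinates on `E × ℝ` with respect to a basis of `E`. -/
def quaternionCoord {E : Type*} [NormedAddCommGroup E] [NormedSpace ℝ E] [FiniteDimensional ℝ E]
    (e : Module.Basis (Fin 3) ℝ E) : (E × ℝ) ≃L[ℝ] Quaternion ℝ :=
  LinearEquiv.toContinuousLinearEquiv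
    { toFun x := ⟨x.2, e.repr x.1 0, e.repr x.1 1, e.repr x.1 2⟩
      invFun q := (q.imI • e 0 + q.imJ • e 1 + q.imK • e 2, q.re)
      map_add' x y := by ext <;> simp <;> rfl
      map_smul' c x := by ext <;> simp <;> rfl
      left_inv x := by
        refine Prod.ext ?_ rfl
        conv_rhs => rw [← e.sum_repr x.1, Fin.sum_univ_three]
      right_inv q := by ext <;> simp }

/-- The bracket on `ℍ` of the sum of `ℝ` and the Lie algebra with structure constants `b`. -/
def bianchiBracket (b : Fin 3 → ℝ) (u v : Quaternion ℝ) : Quaternion ℝ :=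
  ⟨0, b 0 * (u.imJ * v.imK - u.imK * v.imJ), b 1 * (u.imK * v.imI - u.imI * v.imK),
    b 2 * (u.imI * v.imJ - u.imJ * v.imI)⟩

@[simp]
theorem re_bianchiBracket (b : Fin 3 → ℝ) (u v : Quaternion ℝ) :
    (bianchiBracket b u v).re = 0 := rfl

@[simp]
theorem imI_bianchiBracket (b : Fin 3 → ℝ) (u v : Quaternion ℝ) :
    (bianchiBracket b u v).imI = b 0 * (u.imJ * v.imK - u.imK * v.imJ) := rfl

@[simp]
theorem imJ_bianchiBracket (b : Fin 3 → ℝ) (u v : Quaternion ℝ) :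
    (bianchiBracket b u v).imJ = b 1 * (u.imK * v.imI - u.imI * v.imK) := rfl

@[simp]
theorem imK_bianchiBracket (b : Fin 3 → ℝ) (u v : Quaternion ℝ) :
    (bianchiBracket b u v).imK = b 2 * (u.imI * v.imJ - u.imJ * v.imI) := rfl

theorem lie_eq_bianchiBracket {L : Type*} [LieRing L] [LieAlgebra ℝ L]
    {e : Fin 3 → L} {b : Fin 3 → ℝ} (h₀ : ⁅e 1, e 2⁆ = b 0 • e 0) (h₁ : ⁅e 2, e 0⁆ = b 1 • e 1)
    (h₂ : ⁅e 0, e 1⁆ = b 2 • e 2) (u v : Quaternion ℝ) :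
    ⁅u.imI • e 0 + u.imJ • e 1 + u.imK • e 2, v.imI • e 0 + v.imJ • e 1 + v.imK • e 2⁆ =
      (bianchiBracket b u v).imI • e 0 + (bianchiBracket b u v).imJ • e 1 +
        (bianchiBracket b u v).imK • e 2 := by
  have h₀' : ⁅e 2, e 1⁆ = -(b 0 • e 0) := by rw [← h₀, lie_skew]
  have h₁' : ⁅e 0, e 2⁆ = -(b 1 • e 1) := by rw [← h₁, lie_skew]
  have h₂' : ⁅e 1, e 0⁆ = -(b 2 • e 2) := by rw [← h₂, lie_skew]
  simp only [add_lie, lie_add, smul_lie, lie_smul, lie_self, h₀, h₁, h₂, h₀', h₁', h₂',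
    imI_bianchiBracket, imJ_bianchiBracket, imK_bianchiBracket]
  module

namespace IsDiagonalSolution

variable {b : Fin 3 → ℝ} {f₀ f₁ f₂ f₃ : ℝ → ℝ}

/-- The vanishing of the torsion, in terms of the coefficients. -/
theorem torsion_identity (hf : IsDiagonalSolution b f₀ f₁ f₂ f₃) (s : ℝ) (u v : Quaternion ℝ) :
    u.re • quaternionDiag ![deriv f₀ s, deriv f₁ s, deriv f₂ s, deriv f₃ s] v +
        quaternionDiag ![f₀ s, f₁ s, f₂ s, f₃ s] v *
          quaternionDiag ![0, deriv f₁ s / f₀ s, deriv f₂ s / f₀ s, deriv f₃ s / f₀ s] u -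
      (v.re • quaternionDiag ![deriv f₀ s, deriv f₁ s, deriv f₂ s, deriv f₃ s] u +
        quaternionDiag ![f₀ s, f₁ s, f₂ s, f₃ s] u *
          quaternionDiag ![0, deriv f₁ s / f₀ s, deriv f₂ s / f₀ s, deriv f₃ s / f₀ s] v) =
      quaternionDiag ![f₀ s, f₁ s, f₂ s, f₃ s] (bianchiBracket b u v) := by
  have h0 := (hf.pos₀ s).ne'
  have e₁ := hf.eq₁ s
  have e₂ := hf.eq₂ s
  have e₃ := hf.eq₃ s
  ext
  · simp
    field_simp
    ring
  · simp
    field_simp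
    linear_combination (u.imK * v.imJ - u.imJ * v.imK) * e₁
  · simp
    field_simp
    linear_combination (u.imI * v.imK - u.imK * v.imI) * e₂
  · simp
    field_simp
    linear_combination (u.imJ * v.imI - u.imI * v.imJ) * e₃

theorem contDiff (hf : IsDiagonalSolution b f₀ f₁ f₂ f₃) :
    ContDiff ℝ ∞ (fun s ↦ ![f₀ s, f₁ s, f₂ s, f₃ s]) := by
  refine contDiff_pi.2 fun i ↦ ?_
  fin_cases i
  exacts [hf.contDiff₀, hf.contDiff₁, hf.contDiff₂, hf.contDiff₃]

theorem pos (hf : IsDiagonalSolution b f₀ f₁ f₂ f₃) (s : ℝ) (i : Fin 4) :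
    0 < ![f₀ s, f₁ s, f₂ s, f₃ s] i := by
  fin_cases i
  exacts [hf.pos₀ s, hf.pos₁ s, hf.pos₂ s, hf.pos₃ s]

theorem hasDerivAt (hf : IsDiagonalSolution b f₀ f₁ f₂ f₃) (s : ℝ) :
    HasDerivAt (fun s ↦ ![f₀ s, f₁ s, f₂ s, f₃ s])
      ![deriv f₀ s, deriv f₁ s, deriv f₂ s, deriv f₃ s] s := by
  refine hasDerivAt_pi.2 fun i ↦ ?_
  fin_cases i
  exacts [(hf.contDiff₀.differentiable (by simp) s).hasDerivAt,
    (hf.contDiff₁.differentiable (by simp) s).hasDerivAt,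
    (hf.contDiff₂.differentiable (by simp) s).hasDerivAt,
    (hf.contDiff₃.differentiable (by simp) s).hasDerivAt]

end IsDiagonalSolution

theorem contMDiff_clm_apply_comp_snd {E : Type*} [NormedAddCommGroup E] [NormedSpace ℝ E]
    {H : Type*} [TopologicalSpace H] {I : ModelWithCorners ℝ E H}
    {M : Type*} [TopologicalSpace M] [ChartedSpace H M]
    {U V W : Type*} [NormedAddCommGroup U] [NormedSpace ℝ U] [NormedAddCommGroup V]
    [NormedSpace ℝ V] [NormedAddCommGroup W] [NormedSpace ℝ W] (A : U →L[ℝ] V →L[ℝ] W)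
    {F : ℝ → U} (hF : ContDiff ℝ ∞ F) :
    ContMDiff (I.prod 𝓘(ℝ, ℝ)) 𝓘(ℝ, V →L[ℝ] W) ∞ (fun p : M × ℝ ↦ A (F p.2)) :=
  (A.contDiff.comp hF).contMDiff.comp contMDiff_snd

/-! ### Diagonal metrics on `G × ℝ` -/

section Diagonal

open VectorField

variable {E : Type*} [NormedAddCommGroup E] [NormedSpace ℝ E] [FiniteDimensional ℝ E]
  {H : Type*} [TopologicalSpace H] {I : ModelWithCorners ℝ E H}
  {G : Type*} [TopologicalSpace G] [ChartedSpace H G] [Group G] [LieGroup I ∞ G]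

/-- The left invariant quaternionic parallelism of `G × ℝ` given by a basis of the Lie algebra. -/
def basisParallelism (e : Module.Basis (Fin 3) ℝ (GroupLieAlgebra I G)) :
    Parallelism (I.prod 𝓘(ℝ, ℝ)) (G × ℝ) (Quaternion ℝ) :=
  (leftParallelism I G).postcomp (fun _ ↦ quaternionCoord (E := E) e) contMDiff_const

/-- The parallelism whose coefficients in a left invariant parallelism are diagonal and
depend on the real coordinate only. -/
def diagParallelism (e : Module.Basis (Fin 3) ℝ (GroupLieAlgebra I G)) (F : ℝ → Fin 4 → ℝ)
    (hF : ContDiff ℝ ∞ F) (hF' : ∀ s i, 0 < F s i) :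
    Parallelism (I.prod 𝓘(ℝ, ℝ)) (G × ℝ) (Quaternion ℝ) :=
  (basisParallelism e).postcomp (fun p ↦ quaternionDiagEquiv (F p.2) (hF' p.2))
    (contMDiff_clm_apply_comp_snd quaternionDiag hF)

variable (e : Module.Basis (Fin 3) ℝ (GroupLieAlgebra I G)) (F : ℝ → Fin 4 → ℝ)
  (hF : ContDiff ℝ ∞ F) (hF' : ∀ s i, 0 < F s i)

theorem diagParallelism_equiv (p : G × ℝ) (v : TangentSpace (I.prod 𝓘(ℝ, ℝ)) p) :
    (diagParallelism e F hF hF').equiv p v =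
      quaternionDiag (F p.2) ((basisParallelism e).equiv p v) :=
  rfl

theorem basisParallelism_mfderiv_leftDiv (p q : G × ℝ)
    (v : TangentSpace (I.prod 𝓘(ℝ, ℝ)) q) :
    (basisParallelism e).equiv (leftDiv p q)
      (mfderiv (I.prod 𝓘(ℝ, ℝ)) (I.prod 𝓘(ℝ, ℝ)) (leftDiv p) q v) =
    (basisParallelism e).equiv q v :=
  congrArg (quaternionCoord (E := E) e) (leftParallelism_mfderiv_leftDiv I p q v)

theorem constField_basisParallelism (u : Quaternion ℝ) :
    (basisParallelism e).constField u = (leftParallelism I G).constField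
      ((u.imI • e 0 + u.imJ • e 1 + u.imK • e 2 : GroupLieAlgebra I G), u.re) := rfl

theorem mlieBracket_constField_basisParallelism [BoundarylessManifold I G] [I.Boundaryless]
    {b : Fin 3 → ℝ} (h₀ : ⁅e 1, e 2⁆ = b 0 • e 0) (h₁ : ⁅e 2, e 0⁆ = b 1 • e 1)
    (h₂ : ⁅e 0, e 1⁆ = b 2 • e 2) (u v : Quaternion ℝ) (p : G × ℝ) :
    mlieBracket (I.prod 𝓘(ℝ, ℝ)) ((basisParallelism e).constField u)
      ((basisParallelism e).constField v) p =
    (basisParallelism e).constField (bianchiBracket b u v) p := by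
  have : CompleteSpace E := FiniteDimensional.complete ℝ E
  rw [constField_basisParallelism, constField_basisParallelism, constField_basisParallelism,
    mlieBracket_constField_leftParallelism, lie_eq_bianchiBracket h₀ h₁ h₂]
  rfl

theorem isComplete_diagParallelism_metric [I.Boundaryless] (hF1 : ∀ s i, 1 ≤ F s i) :
    (diagParallelism e F hF hF').metric.IsComplete := by
  have : IsTopologicalGroup G := topologicalGroup_of_lieGroup I ∞
  have : LocallyCompactSpace G := Manifold.locallyCompact_of_finiteDimensional I
  refine SmoothMetric.isComplete_of_retract _ (basisParallelism e).metric (1, 0) leftDiv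
    leftTranslate (fun p ↦ (contMDiff_leftDiv I p).of_le (by simp))
    (fun p ↦ (contMDiff_leftTranslate I p).continuous) leftDiv_self leftTranslate_leftDiv
    fun p q v ↦ ?_
  rw [Parallelism.metric_inner, Parallelism.metric_inner, basisParallelism_mfderiv_leftDiv,
    diagParallelism_equiv]
  exact inner_self_le_inner_quaternionDiag (hF1 q.2) _

theorem isGloballyConformal_diagParallelism_metric (c : ℝ → ℝ) (hc : ContDiff ℝ ∞ c)
    (hc' : ∀ s, 0 < c s) :
    (diagParallelism e (fun s ↦ c s • F s) (hc.smul hF)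
      (fun s i ↦ mul_pos (hc' s) (hF' s i))).metric.IsGloballyConformal
    (diagParallelism e F hF hF').metric :=
  ⟨fun p ↦ c p.2 ^ 2, (hc.pow 2).contMDiff.comp contMDiff_snd, fun p ↦ pow_pos (hc' p.2) 2,
    fun _ _ _ ↦ inner_quaternionDiag_smul _ _ _ _⟩

theorem mvfderiv_diagParallelism_constField {F' : ℝ → Fin 4 → ℝ}
    (hd : ∀ s, HasDerivAt F (F' s) s) (u v : Quaternion ℝ) (p : G × ℝ) :
    mvfderiv (I.prod 𝓘(ℝ, ℝ))
      (fun q ↦ (diagParallelism e F hF hF').equiv q ((basisParallelism e).constField v q)) p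
      ((basisParallelism e).constField u p) = u.re • quaternionDiag (F' p.2) v := by
  have h1 : HasFDerivAt (fun s ↦ quaternionDiag (F s) v)
      (ContinuousLinearMap.toSpanSingleton ℝ (quaternionDiag (F' p.2) v)) p.2 :=
    ((quaternionDiag.flip v).hasFDerivAt.comp_hasDerivAt p.2 (hd p.2)).hasFDerivAt
  have h2 := h1.hasMFDerivAt.comp p (hasMFDerivAt_snd p (I := I) (I' := 𝓘(ℝ, ℝ)))
  have h3 : (fun q ↦ (diagParallelism e F hF hF').equiv q ((basisParallelism e).constField v q)) =
      (fun s ↦ quaternionDiag (F s) v) ∘ (Prod.snd : G × ℝ → ℝ) := by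
    ext1 q
    rw [diagParallelism_equiv, Parallelism.equiv_constField]
    rfl
  rw [h3]
  refine congr($(h2.mfderiv) ((basisParallelism e).constField u p)).trans ?_
  have h4 := constField_leftParallelism I
    ((u.imI • e 0 + u.imJ • e 1 + u.imK • e 2 : GroupLieAlgebra I G), u.re) p
  exact congr(($h4).2 • quaternionDiag (F' p.2) v)

theorem isHyperKahler_diagParallelism_metric [BoundarylessManifold I G] [I.Boundaryless]
    {b : Fin 3 → ℝ} (h₀ : ⁅e 1, e 2⁆ = b 0 • e 0) (h₁ : ⁅e 2, e 0⁆ = b 1 • e 1)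
    (h₂ : ⁅e 0, e 1⁆ = b 2 • e 2) {f₀ f₁ f₂ f₃ : ℝ → ℝ}
    (hf : IsDiagonalSolution b f₀ f₁ f₂ f₃) :
    (diagParallelism e _ hf.contDiff hf.pos).metric.IsHyperKahler := by
  have : CompleteSpace E := FiniteDimensional.complete ℝ E
  refine Parallelism.isHyperKahler_metric _ (fun p ↦ quaternionDiag
    ![0, deriv f₁ p.2 / f₀ p.2, deriv f₂ p.2 / f₀ p.2, deriv f₃ p.2 / f₀ p.2] ∘L
      ((basisParallelism e).equiv p : _ →L[ℝ] Quaternion ℝ)) (fun p v ↦ by simp) ?_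
  ext1 p
  ext1 x
  ext1 y
  obtain ⟨u, rfl⟩ : ∃ u, (basisParallelism e).constField u p = x :=
    ⟨_, ((basisParallelism e).equiv p).symm_apply_apply x⟩
  obtain ⟨v, rfl⟩ : ∃ v, (basisParallelism e).constField v p = y :=
    ⟨_, ((basisParallelism e).equiv p).symm_apply_apply y⟩
  rw [CovariantDerivative.torsion_apply _
    ((basisParallelism e).vectorFieldDiffAt_constField u p)
    ((basisParallelism e).vectorFieldDiffAt_constField v p),
    mlieBracket_constField_basisParallelism e h₀ h₁ h₂]
  apply ((diagParallelism e _ hf.contDiff hf.pos).equiv p).injective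
  rw [map_sub, map_sub, Parallelism.quaternionicConnection_apply,
    Parallelism.quaternionicConnection_apply,
    mvfderiv_diagParallelism_constField e _ hf.contDiff hf.pos hf.hasDerivAt,
    mvfderiv_diagParallelism_constField e _ hf.contDiff hf.pos hf.hasDerivAt]
  simp only [diagParallelism_equiv, ContinuousLinearMap.comp_apply, ContinuousLinearEquiv.coe_coe,
    Parallelism.equiv_constField]
  refine (sub_eq_zero.2 (hf.torsion_identity p.2 u v)).trans ?_
  simp only [Pi.zero_apply, zero_apply, map_zero]

end Diagonal

end

theorem mainTheorem4 {G : Type*} [TopologicalSpace G] [Group G]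
    [ChartedSpace (EuclideanSpace ℝ (Fin 3)) G] [LieGroup (𝓡 3) ∞ G]
    (hG : IsBianchiTypeA (GroupLieAlgebra (𝓡 3) G)) :
    ∃ ghat g : SmoothMetric ((𝓡 3).prod 𝓘(ℝ, ℝ)) (G × ℝ),
      ghat.IsComplete ∧ g.IsHyperKahler ∧ ghat.IsGloballyConformal g := by
  obtain ⟨t, e, h₀, h₁, h₂⟩ := hG
  obtain ⟨f₀, f₁, f₂, f₃, hf⟩ := exists_isDiagonalSolution t
  have hinv : ContDiff ℝ ∞ fun s ↦ (∑ i, (![f₀ s, f₁ s, f₂ s, f₃ s] i)⁻¹) :=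
    ContDiff.sum fun i _ ↦ (contDiff_pi.1 hf.contDiff i).inv fun s ↦ (hf.pos s i).ne'
  have hpos (s : ℝ) : 0 < ∑ i, (![f₀ s, f₁ s, f₂ s, f₃ s] i)⁻¹ :=
    Finset.sum_pos (fun i _ ↦ inv_pos.2 (hf.pos s i)) Finset.univ_nonempty
  refine ⟨_, _, isComplete_diagParallelism_metric e _ _ _ fun s i ↦ ?_,
    isHyperKahler_diagParallelism_metric e h₀ h₁ h₂ hf,
    isGloballyConformal_diagParallelism_metric e _ hf.contDiff hf.pos _ hinv hpos⟩
  calc (1 : ℝ) = (![f₀ s, f₁ s, f₂ s, f₃ s] i)⁻¹ * ![f₀ s, f₁ s, f₂ s, f₃ s] i :=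
      (inv_mul_cancel₀ (hf.pos s i).ne').symm
    _ ≤ _ := mul_le_mul_of_nonneg_right (Finset.single_le_sum
      (f := fun i ↦ (![f₀ s, f₁ s, f₂ s, f₃ s] i)⁻¹)
      (fun j _ ↦ (inv_pos.2 (hf.pos s j)).le) (Finset.mem_univ i)) (hf.pos s i).le
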